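/- Let $\mathbb F_q$ be a fixed finite field. For every $n$ let $v_1,v_2,\dots$ be independent uniformly random vectors in $\mathbb F_q^n$, let $A_m=[v_1,\dots,v_m]$ be the $n\times m$ matrix whose columns are the first $m$ of them, and let $M[A_m]$ be the matroid represented by $A_m$: its ground set is the set of the $m$ columns (repeated columns count as different elements), and a set of columns is independent if it is linearly independent. For a finite matroid $M$ with rank function $\mathrm{rk}$ and an integer $k\ge 1$, a partition $(X,Y)$ of the ground set of $M$ with $\mathrm{rk}(X)+\mathrm{rk}(Y)-\mathrm{rk}(M)\le k-1$ is a vertical $k$-separation if $\min\{\mathrm{rk}(X),\mathrm{rk}(Y)\}\ge k$, and a Tutte $k$-separation if $\min\{|X|,|Y|\}\ge k$. The vertical connectivity $\kappa(M)$ (respectively the Tutte connectivity $t(M)$) is the smallest $k$ such that $M$ has a vertical (respectively Tutte) $k$-separation, and $\infty$ if there is no such $k$. An event holds a.a.s. if its probability tends to $1$ as $n\to\infty$. Theorem. (a) A.a.s. $\kappa(M[A_m])\le\kappa(M[A_{m'}])$ for all $2\le m\le m'$. (b) For every function $f$ with $f(n)=o(n)$, a.a.s. $t(M[A_m])=\kappa(M[A_m])$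 for all $m\ge 1$ with $|m-n|\le f(n)$. (c) There are constants $c,C>0$ that depend only on $q$ such that a.a.s. there is an integer $\hat m$ with $cn\le\hat m\le Cn$, $t(M[A_m])=\kappa(M[A_m])$ for all $1\le m<\hat m$, and $t(M[A_m])<\kappa(M[A_m])$ for all $m\ge\hat m$. -/

import Mathlib

open MeasureTheory ProbabilityTheory Filter Topology Asymptotics

noncomputable section

namespace RandomMatroid

/-! ### The matroid represented by a matrix -/

/-- Augmentation for linearly independent families of columns. -/
theorem exists_insert_linearIndepOn {F V E : Type*} [Field F] [AddCommGroup V] [Module F V]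
    [Finite E] {v : E → V} {I J : Set E} (hI : LinearIndepOn F v I) (hJ : LinearIndepOn F v J)
    (hlt : I.ncard < J.ncard) : ∃ e ∈ J, e ∉ I ∧ LinearIndepOn F v (insert e I) := by
  by_contra! h
  have hsub : Submodule.span F (v '' J) ≤ Submodule.span F (v '' I) := by
    rw [Submodule.span_le]
    rintro _ ⟨e, he, rfl⟩
    by_cases heI : e ∈ I
    · exact Submodule.subset_span ⟨e, heI, rfl⟩
    · by_contra hspan
      exact h e he heI (hI.insert hspan)
  have h1 := toENat_rank_span_set hI
  have h2 := toENat_rank_span_set hJ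
  have h3 : (Module.rank F (Submodule.span F (v '' J))).toENat
      ≤ (Module.rank F (Submodule.span F (v '' I))).toENat := by
    gcongr
    exact Submodule.rank_mono hsub
  rw [h1, h2, ← (Set.toFinite I).cast_ncard_eq, ← (Set.toFinite J).cast_ncard_eq] at h3
  exact absurd (Nat.cast_le.1 h3) (not_le.2 hlt)

/-- The matroid represented by the matrix `A`: its elements are (the indices of) the columns of
`A`, and a set of columns is independent if the family of these columns is linearly independent.
Repeated columns are different elements. -/
def matrixMatroid {F R E : Type*} [Field F] [Finite E] (A : Matrix R E F) : Matroid E :=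
  (IndepMatroid.ofFinite (E := Set.univ) Set.finite_univ
    (fun S => LinearIndepOn F A.col S)
    (linearIndepOn_empty F _)
    (fun _ _ hJ hIJ => hJ.mono hIJ)
    (fun _ _ hI hJ hlt => exists_insert_linearIndepOn hI hJ hlt)
    (fun _ _ => Set.subset_univ _)).matroid

/-! ### Vertical and Tutte connectivity (of matroids of finite rank) -/

/-- `(X, Y)` is a vertical `k`-separation of `M`, `k ≥ 1`: a partition of the ground set with
`min (rk X) (rk Y) ≥ k` and `rk X + rk Y - rk M ≤ k - 1`. -/
structure IsVerticalSeparation {α : Type*} (M : Matroid α) (k : ℕ) (X Y : Set α) : Prop where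
  one_le : 1 ≤ k
  union_eq : X ∪ Y = M.E
  disjoint : Disjoint X Y
  le_left : (k : ℕ∞) ≤ M.eRk X
  le_right : (k : ℕ∞) ≤ M.eRk Y
  rank_le : M.eRk X + M.eRk Y + 1 ≤ M.eRank + k

/-- `(X, Y)` is a Tutte `k`-separation of `M`, `k ≥ 1`: a partition of the ground set with
`min |X| |Y| ≥ k` and `rk X + rk Y - rk M ≤ k - 1`. -/
structure IsTutteSeparation {α : Type*} (M : Matroid α) (k : ℕ) (X Y : Set α) : Prop where
  one_le : 1 ≤ k
  union_eq : X ∪ Y = M.E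
  disjoint : Disjoint X Y
  le_left : (k : ℕ∞) ≤ X.encard
  le_right : (k : ℕ∞) ≤ Y.encard
  rank_le : M.eRk X + M.eRk Y + 1 ≤ M.eRank + k

/-- The vertical connectivity `κ(M)`: the smallest `k` such that `M` has a vertical
`k`-separation, and `∞` if there is none. -/
def verticalConnectivity {α : Type*} (M : Matroid α) : ℕ∞ :=
  ⨅ (k : ℕ) (_ : ∃ X Y, IsVerticalSeparation M k X Y), (k : ℕ∞)

/-- The Tutte connectivity `t(M)`: the smallest `k` such that `M` has a Tutte `k`-separation,
and `∞` if there is none. -/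
def tutteConnectivity {α : Type*} (M : Matroid α) : ℕ∞ :=
  ⨅ (k : ℕ) (_ : ∃ X Y, IsTutteSeparation M k X Y), (k : ℕ∞)

/-! ### The random process of columns -/

/-- The law of a sequence `v₁, v₂, …` of independent uniformly random vectors in `F ^ n`
(`v₁` is the term of index `0` of the sequence). -/
def columnLaw (F : Type*) [Field F] [Fintype F] [MeasurableSpace F] (n : ℕ) :
    Measure (ℕ → Fin n → F) :=
  Measure.infinitePi (fun _ : ℕ => (PMF.uniformOfFintype (Fin n → F)).toMeasure)

/-- The `n × m` matrix `A_m = [v₁, …, v_m]` formed by the first `m` vectors of the sequence. -/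
def columnMatrix {F : Type*} {n : ℕ} (v : ℕ → Fin n → F) (m : ℕ) : Matrix (Fin n) (Fin m) F :=
  Matrix.of fun i j => v j i

/-- `κ(M[A_m])`. -/
def kappa {F : Type*} [Field F] {n : ℕ} (v : ℕ → Fin n → F) (m : ℕ) : ℕ∞ :=
  verticalConnectivity (matrixMatroid (columnMatrix v m))

/-- `t(M[A_m])`. -/
def tutte {F : Type*} [Field F] {n : ℕ} (v : ℕ → Fin n → F) (m : ℕ) : ℕ∞ :=
  tutteConnectivity (matrixMatroid (columnMatrix v m))

/-- The events `S n` occur asymptotically almost surely: the probability that `v₁, v₂, …` lies in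
`S n` tends to `1` as `n → ∞`. -/
def AAS (F : Type*) [Field F] [Fintype F] [MeasurableSpace F]
    (S : ∀ n : ℕ, Set (ℕ → Fin n → F)) : Prop :=
  Tendsto (fun n : ℕ => columnLaw F n (S n)) atTop (𝓝 1)

end RandomMatroid

end

/-! Let q = |F| and let w = `window F n`, so q^(2w) ≤ n and w → ∞. With high probability
(`IsTypical`) the first n - w columns are independent, the first n + w span, and some column is a
coloop among the first n + w. The first two events fail with probability at most q^(-w) by union
bounds; the third is a second moment argument (`measureReal_compl_iUnion_mul_le`).

(a) A coloop against the rest is a vertical 1-separation, so κ = 1 for 2 ≤ m ≤ n + w. Afterwards the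
rank stays n, and restricting a separation to fewer columns of the same rank does not raise its
order (`kappa_mono`).

(b) If t < κ, an optimal Tutte k-separation has a spanning side, and its other side has at least k
elements but rank below k, hence contains a dependent set of size k < κ. Near m = n, κ is at most
about m minus the rank, which is o(n) (`kappa_le_of_colRank`), whereas the first 2n columns have no
dependent set of size at most n/K (`exists_highProb_noShortRelation`).

(c) Once the rank is n, t < κ persists: each new column joins the spanning side
(`tutte_lt_kappa_succ`). It cannot occur up to n + w, where κ = 1 or no separation exists. It does
occur by m = Cn: two hyperplanes then no longer cover the columns, so κ = ∞, while t ≤ n + 1. -/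

namespace RandomMatroid

/-! ### Ranks of sets of columns -/

section Rank

variable {F : Type*} [Field F] {n : ℕ} {v : ℕ → Fin n → F}

/-- The rank of the set of those columns of the sequence whose index lies in `S`. -/
noncomputable def colRank (v : ℕ → Fin n → F) (S : Set ℕ) : ℕ := Set.finrank F (v '' S)

theorem matrixMatroid_indep_iff {R E : Type*} [Finite E] {A : Matrix R E F} {I : Set E} :
    (matrixMatroid A).Indep I ↔ LinearIndepOn F A.col I := by
  simp [matrixMatroid]

theorem matrixMatroid_ground {R E : Type*} [Finite E] (A : Matrix R E F) :
    (matrixMatroid A).E = Set.univ := by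
  simp [matrixMatroid]

/-- A matroid basis of `X` spans all its columns, since a column outside the span could be added.
Passing to subsets of ℕ makes separations for different `m` comparable. -/
theorem eRk_matrixMatroid_columnMatrix (m : ℕ) (X : Set (Fin m)) :
    (matrixMatroid (columnMatrix v m)).eRk X = (colRank v (Fin.val '' X) : ℕ∞) := by
  obtain ⟨I, hI⟩ := (matrixMatroid (columnMatrix v m)).exists_isBasis X
    (by simp [matrixMatroid_ground])
  have hind := matrixMatroid_indep_iff.1 hI.indep
  have hspan : Submodule.span F ((columnMatrix v m).col '' X)
      = Submodule.span F ((columnMatrix v m).col '' I) := by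
    refine le_antisymm (Submodule.span_le.2 ?_) (Submodule.span_mono (Set.image_mono hI.subset))
    rintro _ ⟨e, he, rfl⟩
    by_cases heI : e ∈ I
    · exact Submodule.subset_span ⟨e, heI, rfl⟩
    · by_contra hs
      exact heI (hI.mem_of_insert_indep he (matrixMatroid_indep_iff.2 (hind.insert hs)))
  have himage : v '' (Fin.val '' X) = (columnMatrix v m).col '' X := by
    rw [Set.image_image]; rfl
  rw [← hI.encard_eq_eRk, ← toENat_rank_span_set hind, ← hspan, colRank, Set.finrank, himage,
    ← Module.finrank_eq_rank]
  simp

theorem eRank_matrixMatroid_columnMatrix (m : ℕ) :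
    (matrixMatroid (columnMatrix v m)).eRank = (colRank v (Set.Iio m) : ℕ∞) := by
  rw [← Matroid.eRk_ground, matrixMatroid_ground, eRk_matrixMatroid_columnMatrix, Set.image_univ,
    Fin.range_val]

theorem colRank_mono {S T : Set ℕ} (h : S ⊆ T) : colRank v S ≤ colRank v T :=
  Submodule.finrank_mono (Submodule.span_mono (Set.image_mono h))

theorem colRank_le (S : Set ℕ) : colRank v S ≤ n := by
  simpa [colRank, Set.finrank] using Submodule.finrank_le (Submodule.span F (v '' S))

theorem colRank_union_le (S T : Set ℕ) : colRank v (S ∪ T) ≤ colRank v S + colRank v T := by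
  rw [colRank, Set.image_union, Set.finrank, Submodule.span_union]
  exact Submodule.finrank_add_le_finrank_add_finrank _ _

theorem colRank_le_ncard {S : Set ℕ} (hS : S.Finite) : colRank v S ≤ S.ncard := by
  have := (hS.image v).fintype
  have h := finrank_span_le_card (R := F) (v '' S)
  rw [← Set.ncard_eq_toFinset_card'] at h
  exact h.trans (Set.ncard_image_le hS)

theorem colRank_eq_ncard {S : Set ℕ} (h : LinearIndepOn F v S) : colRank v S = S.ncard := by
  have h1 := toENat_rank_span_set h
  rw [← Module.finrank_eq_rank] at h1
  simp only [map_natCast] at h1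
  rw [colRank, Set.finrank, Set.ncard, ← h1]
  simp

end Rank

/-! ### Separations as partitions of an initial segment -/

section Separations

variable {F : Type*} [Field F] {n : ℕ} {v : ℕ → Fin n → F} {m k : ℕ}

/-- `(X, Y)` is a partition of the first `m` columns. -/
def IsPartition (m : ℕ) (X Y : Set ℕ) : Prop := X ∪ Y = Set.Iio m ∧ Disjoint X Y

theorem IsPartition.symm {X Y : Set ℕ} (h : IsPartition m X Y) : IsPartition m Y X :=
  ⟨by rw [Set.union_comm, h.1], h.2.symm⟩

theorem IsPartition.left_subset {X Y : Set ℕ} (h : IsPartition m X Y) : X ⊆ Set.Iio m :=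
  h.1 ▸ Set.subset_union_left

theorem IsPartition.right_subset {X Y : Set ℕ} (h : IsPartition m X Y) : Y ⊆ Set.Iio m :=
  h.1 ▸ Set.subset_union_right

theorem IsPartition.left_finite {X Y : Set ℕ} (h : IsPartition m X Y) : X.Finite :=
  (Set.finite_Iio m).subset h.left_subset

theorem IsPartition.colRank_le_add {X Y : Set ℕ} (h : IsPartition m X Y) :
    colRank v (Set.Iio m) ≤ colRank v X + colRank v Y :=
  h.1 ▸ colRank_union_le X Y

theorem isPartition_image {X Y : Set (Fin m)} (h : X ∪ Y = Set.univ) (hd : Disjoint X Y) :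
    IsPartition m (Fin.val '' X) (Fin.val '' Y) := by
  refine ⟨?_, (Set.disjoint_image_iff Fin.val_injective).2 hd⟩
  rw [← Set.image_union, h, Set.image_univ, Fin.range_val]

theorem exists_isVerticalSeparation_iff :
    (∃ X Y, IsVerticalSeparation (matrixMatroid (columnMatrix v m)) k X Y) ↔
      1 ≤ k ∧ ∃ X Y, IsPartition m X Y ∧ k ≤ colRank v X ∧ k ≤ colRank v Y ∧
        colRank v X + colRank v Y + 1 ≤ colRank v (Set.Iio m) + k := by
  constructor
  · rintro ⟨X, Y, h1, h2, h3, h4, h5, h6⟩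
    rw [matrixMatroid_ground] at h2
    rw [eRk_matrixMatroid_columnMatrix] at h4 h5
    rw [eRk_matrixMatroid_columnMatrix, eRk_matrixMatroid_columnMatrix,
      eRank_matrixMatroid_columnMatrix] at h6
    exact ⟨h1, _, _, isPartition_image h2 h3, by exact_mod_cast h4, by exact_mod_cast h5,
      by exact_mod_cast h6⟩
  · rintro ⟨h1, X, Y, h2, h4, h5, h6⟩
    have hX : Fin.val '' (Fin.val ⁻¹' X : Set (Fin m)) = X := by
      rw [Set.image_preimage_eq_inter_range, Fin.range_val,
        Set.inter_eq_left.2 h2.left_subset]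
    have hY : Fin.val '' (Fin.val ⁻¹' Y : Set (Fin m)) = Y := by
      rw [Set.image_preimage_eq_inter_range, Fin.range_val,
        Set.inter_eq_left.2 h2.right_subset]
    refine ⟨Fin.val ⁻¹' X, Fin.val ⁻¹' Y, h1, ?_, h2.2.preimage _, ?_, ?_, ?_⟩
    · rw [matrixMatroid_ground, ← Set.preimage_union, h2.1]
      ext x; simp
    · rw [eRk_matrixMatroid_columnMatrix, hX]; exact_mod_cast h4
    · rw [eRk_matrixMatroid_columnMatrix, hY]; exact_mod_cast h5
    · rw [eRk_matrixMatroid_columnMatrix, eRk_matrixMatroid_columnMatrix,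
        eRank_matrixMatroid_columnMatrix, hX, hY]
      exact_mod_cast h6

theorem exists_isTutteSeparation_iff :
    (∃ X Y, IsTutteSeparation (matrixMatroid (columnMatrix v m)) k X Y) ↔
      1 ≤ k ∧ ∃ X Y, IsPartition m X Y ∧ k ≤ X.ncard ∧ k ≤ Y.ncard ∧
        colRank v X + colRank v Y + 1 ≤ colRank v (Set.Iio m) + k := by
  have hcard : ∀ X : Set (Fin m), X.encard = ((Fin.val '' X).ncard : ℕ∞) := fun X => by
    rw [Set.ncard_image_of_injective _ Fin.val_injective, (Set.toFinite X).cast_ncard_eq]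
  constructor
  · rintro ⟨X, Y, h1, h2, h3, h4, h5, h6⟩
    rw [matrixMatroid_ground] at h2
    rw [hcard] at h4 h5
    rw [eRk_matrixMatroid_columnMatrix, eRk_matrixMatroid_columnMatrix,
      eRank_matrixMatroid_columnMatrix] at h6
    exact ⟨h1, _, _, isPartition_image h2 h3, by exact_mod_cast h4, by exact_mod_cast h5,
      by exact_mod_cast h6⟩
  · rintro ⟨h1, X, Y, h2, h4, h5, h6⟩
    have hX : Fin.val '' (Fin.val ⁻¹' X : Set (Fin m)) = X := by
      rw [Set.image_preimage_eq_inter_range, Fin.range_val,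
        Set.inter_eq_left.2 h2.left_subset]
    have hY : Fin.val '' (Fin.val ⁻¹' Y : Set (Fin m)) = Y := by
      rw [Set.image_preimage_eq_inter_range, Fin.range_val,
        Set.inter_eq_left.2 h2.right_subset]
    refine ⟨Fin.val ⁻¹' X, Fin.val ⁻¹' Y, h1, ?_, h2.2.preimage _, ?_, ?_, ?_⟩
    · rw [matrixMatroid_ground, ← Set.preimage_union, h2.1]
      ext x; simp
    · rw [hcard, hX]; exact_mod_cast h4
    · rw [hcard, hY]; exact_mod_cast h5
    · rw [eRk_matrixMatroid_columnMatrix, eRk_matrixMatroid_columnMatrix,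
        eRank_matrixMatroid_columnMatrix, hX, hY]
      exact_mod_cast h6

theorem exists_of_iInf_lt {P : ℕ → Prop} {a : ℕ∞} (h : ⨅ (k : ℕ) (_ : P k), (k : ℕ∞) < a) :
    ∃ k, P k ∧ (k : ℕ∞) = ⨅ (k : ℕ) (_ : P k), (k : ℕ∞) := by
  classical
  have hex : ∃ k, P k := by
    by_contra! hno
    have : ⨅ (k : ℕ) (_ : P k), (k : ℕ∞) = ⊤ := by simp [hno]
    rw [this] at h
    exact not_top_lt h
  refine ⟨Nat.find hex, Nat.find_spec hex, le_antisymm ?_ (iInf₂_le _ (Nat.find_spec hex))⟩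
  exact le_iInf₂ fun k hk => by exact_mod_cast Nat.find_min' hex hk

theorem one_le_kappa : 1 ≤ kappa v m :=
  le_iInf₂ fun _ hk => by exact_mod_cast (exists_isVerticalSeparation_iff.1 hk).1

theorem one_le_tutte : 1 ≤ tutte v m :=
  le_iInf₂ fun _ hk => by exact_mod_cast (exists_isTutteSeparation_iff.1 hk).1

theorem tutte_le_kappa : tutte v m ≤ kappa v m := by
  refine le_iInf₂ fun k hk => iInf₂_le k ?_
  obtain ⟨h1, X, Y, h2, h3, h4, h5⟩ := exists_isVerticalSeparation_iff.1 hk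
  exact exists_isTutteSeparation_iff.2 ⟨h1, X, Y, h2,
    h3.trans (colRank_le_ncard h2.left_finite), h4.trans (colRank_le_ncard h2.symm.left_finite),
    h5⟩

/-- A partition into two nonspanning sets bounds the vertical connectivity. -/
theorem kappa_le_of_isPartition {X Y : Set ℕ} (h : IsPartition m X Y)
    (hX : colRank v X < colRank v (Set.Iio m)) (hY : colRank v Y < colRank v (Set.Iio m))
    (hk : colRank v X + colRank v Y + 1 ≤ colRank v (Set.Iio m) + k) : kappa v m ≤ k := by
  have hle := h.colRank_le_add (v := v)
  -- This is the least order that the rank inequality permits. For it, rk X ≥ k says exactly that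
  -- `Y` is nonspanning, and conversely; subadditivity gives k ≥ 1.
  have hle' : kappa v m ≤ (colRank v X + colRank v Y + 1 - colRank v (Set.Iio m) : ℕ) := by
    refine iInf₂_le (colRank v X + colRank v Y + 1 - colRank v (Set.Iio m))
      (exists_isVerticalSeparation_iff.2 ⟨?_, X, Y, h, ?_, ?_, ?_⟩) <;> omega
  refine hle'.trans ?_
  norm_cast
  omega

/-- The rank inequality and k ≤ rk Y force rk X < rk M, and symmetrically. Hence finite κ is the
minimum of rk X + rk Y - rk M + 1 over partitions into nonspanning sets. -/
theorem exists_isPartition_of_kappa_lt {a : ℕ∞} (h : kappa v m < a) :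
    ∃ k : ℕ, (k : ℕ∞) = kappa v m ∧ ∃ X Y, IsPartition m X Y ∧
      colRank v X < colRank v (Set.Iio m) ∧ colRank v Y < colRank v (Set.Iio m) ∧
      colRank v X + colRank v Y + 1 ≤ colRank v (Set.Iio m) + k := by
  obtain ⟨k, hk, hk'⟩ := exists_of_iInf_lt h
  obtain ⟨-, X, Y, h2, h3, h4, h5⟩ := exists_isVerticalSeparation_iff.1 hk
  exact ⟨k, hk', X, Y, h2, by omega, by omega, h5⟩

/-- Intersecting both sides with the first `m` columns can only lower their ranks, while the total
rank is unchanged; so the sides stay nonspanning and the order does not grow. -/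
theorem kappa_mono {m' : ℕ} (hm : m ≤ m')
    (hr : colRank v (Set.Iio m) = colRank v (Set.Iio m')) : kappa v m ≤ kappa v m' := by
  by_contra! hlt
  obtain ⟨k, hk, X, Y, hP, hX, hY, hle⟩ := exists_isPartition_of_kappa_lt hlt
  rw [← hk] at hlt
  refine absurd hlt (not_lt.2 (kappa_le_of_isPartition (X := X ∩ Set.Iio m) (Y := Y ∩ Set.Iio m)
    ⟨?_, hP.2.mono Set.inter_subset_left Set.inter_subset_left⟩ ?_ ?_ ?_))
  · rw [← Set.union_inter_distrib_right, hP.1]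
    exact Set.inter_eq_right.2 (Set.Iio_subset_Iio hm)
  all_goals
    have h1 := colRank_mono (v := v) (Set.inter_subset_left (s := X) (t := Set.Iio m))
    have h2 := colRank_mono (v := v) (Set.inter_subset_left (s := Y) (t := Set.Iio m))
    omega

theorem kappa_eq_one {j : ℕ} (hj : j < m) (hr : 2 ≤ colRank v (Set.Iio m))
    (hcoloop : colRank v (Set.Iio m \ {j}) < colRank v (Set.Iio m)) : kappa v m = 1 := by
  have h1 : colRank v {j} ≤ 1 := by
    simpa using colRank_le_ncard (v := v) (Set.finite_singleton j)
  refine le_antisymm (kappa_le_of_isPartition (k := 1) (X := {j}) (Y := Set.Iio m \ {j})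
    ⟨Set.union_sdiff_cancel (by simpa using hj), Set.disjoint_sdiff_right⟩ ?_ hcoloop ?_)
    one_le_kappa <;> omega

/-- Separate `r` elements of a basis from the other m - r columns. The hypothesis `hm` says m - r <
r + 1, so the second side is too small to span. -/
theorem kappa_le_of_colRank {r : ℕ} (hr : colRank v (Set.Iio m) = r + 1)
    (hm : m < 2 * r + 1) : kappa v m ≤ (m - r : ℕ) := by
  obtain ⟨B, hB, -, hBspan, hind⟩ := exists_linearIndepOn_extension (K := F) (v := v)
    (linearIndepOn_empty F v) (Set.empty_subset (Set.Iio m))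
  have hBfin : B.Finite := (Set.finite_Iio m).subset hB
  have hBr : colRank v B = r + 1 := by
    rw [← hr]
    exact le_antisymm (colRank_mono hB) (Submodule.finrank_mono (Submodule.span_le.2 hBspan))
  have hBcard : B.ncard = r + 1 := by rw [← colRank_eq_ncard hind, hBr]
  obtain ⟨Y, hYB, hY⟩ := Set.exists_subset_card_eq (s := B) (n := r) (by omega)
  have hYr : colRank v Y = r := by rw [colRank_eq_ncard (hind.mono hYB), hY]
  have hXcard : (Set.Iio m \ Y).ncard = m - r := by
    rw [Set.ncard_sdiff (hYB.trans hB) (hBfin.subset hYB), hY]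
    simp [Set.ncard_eq_toFinset_card']
  have hX := colRank_le_ncard (v := v) ((Set.finite_Iio m).subset (Set.sdiff_subset (t := Y)))
  have hmr : r < m := by
    have := colRank_le_ncard (v := v) (Set.finite_Iio m)
    simp only [Set.ncard_eq_toFinset_card', Set.toFinset_Iio, Nat.card_Iio] at this
    omega
  refine kappa_le_of_isPartition (X := Set.Iio m \ Y) (Y := Y)
    ⟨Set.sdiff_union_of_subset (hYB.trans hB), Set.disjoint_sdiff_left⟩ ?_ ?_ ?_ <;> omega

/-- If the Tutte connectivity is smaller than the vertical connectivity, it is attained at a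
partition one part of which is spanning. -/
theorem exists_isPartition_of_tutte_lt_kappa (h : tutte v m < kappa v m) :
    ∃ k : ℕ, (k : ℕ∞) = tutte v m ∧ 1 ≤ k ∧ ∃ X Y, IsPartition m X Y ∧
      k ≤ X.ncard ∧ k ≤ Y.ncard ∧ colRank v X = colRank v (Set.Iio m) ∧ colRank v Y < k := by
  obtain ⟨k, hk, hk'⟩ := exists_of_iInf_lt h
  obtain ⟨h1, X, Y, h2, h3, h4, h5⟩ := exists_isTutteSeparation_iff.1 hk
  have hX := colRank_mono (v := v) h2.left_subset
  have hY := colRank_mono (v := v) h2.right_subset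
  refine ⟨k, hk', h1, ?_⟩
  rcases hX.eq_or_lt with hX | hX
  · exact ⟨X, Y, h2, h3, h4, hX, by omega⟩
  rcases hY.eq_or_lt with hY | hY
  · exact ⟨Y, X, h2.symm, h4, h3, hY, by omega⟩
  -- Two nonspanning sides would bound κ by the same `k`, that is, by t.
  refine absurd h (not_lt.2 ((kappa_le_of_isPartition h2 hX hY h5).trans hk'.le))

/-- If t = k < κ ≤ s, the side of rank below `k` has a `k`-subset, which is independent because k ≤
s: a contradiction. -/
theorem tutte_eq_kappa_of_linearIndepOn {s : ℕ}
    (hs : ∀ Y ⊆ Set.Iio m, Y.ncard ≤ s → LinearIndepOn F v Y) (hk : kappa v m ≤ s) :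
    tutte v m = kappa v m := by
  refine tutte_le_kappa.antisymm (not_lt.1 fun hlt => ?_)
  obtain ⟨k, hk', h1, X, Y, hP, -, hY, -, hlt'⟩ := exists_isPartition_of_tutte_lt_kappa hlt
  obtain ⟨Z, hZY, hZ⟩ := Set.exists_subset_card_eq hY
  have hks : k ≤ s := by
    have := hlt.le.trans hk
    rw [← hk'] at this
    exact_mod_cast this
  have := colRank_eq_ncard (hs Z (hZY.trans hP.right_subset) (by omega))
  have := colRank_mono (v := v) hZY
  omega

/-- The new column joins the spanning side, whose rank cannot grow. So t(m + 1) ≤ t(m) < κ(m) ≤ κ(m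
+ 1). -/
theorem tutte_lt_kappa_succ (hr : colRank v (Set.Iio m) = colRank v (Set.Iio (m + 1)))
    (h : tutte v m < kappa v m) : tutte v (m + 1) < kappa v (m + 1) := by
  obtain ⟨k, hk, h1, X, Y, hP, hX, hY, hXr, hYr⟩ := exists_isPartition_of_tutte_lt_kappa h
  refine lt_of_le_of_lt ?_ (h.trans_le (kappa_mono m.le_succ hr))
  rw [← hk]
  refine iInf₂_le k (exists_isTutteSeparation_iff.2 ⟨h1, insert m X, Y, ⟨?_, ?_⟩, ?_, hY, ?_⟩)
  · rw [Set.insert_union, hP.1]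
    ext x; simp
  · rw [Set.disjoint_insert_left]
    exact ⟨fun hm => lt_irrefl m (hP.right_subset hm), hP.2⟩
  · exact hX.trans (Set.ncard_le_ncard (Set.subset_insert _ _) (hP.left_finite.insert m))
  · have : colRank v (insert m X) ≤ colRank v (Set.Iio (m + 1)) :=
      colRank_mono (Set.insert_subset (by simp)
        (hP.left_subset.trans (Set.Iio_subset_Iio m.le_succ)))
    omega

theorem tutte_lt_top (hm : 2 * n + 2 ≤ m) : tutte v m < ⊤ := by
  -- Any partition into two sides of at least n + 1 columns works, since a side has rank at most n.
  refine lt_of_le_of_lt (iInf₂_le (n + 1) (exists_isTutteSeparation_iff.2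
    ⟨by omega, Set.Iio (n + 1), Set.Ico (n + 1) m, ⟨?_, ?_⟩, ?_, ?_, ?_⟩)) (ENat.natCast_lt_top _)
  · ext x; simp; omega
  · rw [Set.disjoint_left]; intro x; simp; omega
  · simp [Set.ncard_eq_toFinset_card']
  · simp [Set.ncard_eq_toFinset_card']; omega
  · have h1 := colRank_mono (v := v) (Set.Iio_subset_Iio (show n + 1 ≤ m by omega))
    have h2 := colRank_le (v := v) (Set.Ico (n + 1) m)
    omega

end Separations

/-! ### Deterministic consequences of the typical behaviour of the columns -/

section Deterministic

variable {F : Type*} [Field F] {n : ℕ} {v : ℕ → Fin n → F} {m k s w : ℕ}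

/-- There is no nontrivial linear relation between at most `s` of the first `k` columns. -/
def NoShortRelation [DecidableEq F] (v : ℕ → Fin n → F) (k s : ℕ) : Prop :=
  ∀ x : Fin k → F, ∑ j, x j • v j = 0 → hammingNorm x ≤ s → x = 0

theorem NoShortRelation.linearIndepOn [DecidableEq F] (h : NoShortRelation v k s) {Y : Set ℕ}
    (hY : Y ⊆ Set.Iio k) (hs : Y.ncard ≤ s) : LinearIndepOn F v Y := by
  classical
  have hYf : Y.Finite := (Set.finite_Iio k).subset hY
  rw [linearIndepOn_iff']
  intro t g ht hsum i hi
  have htk : t ⊆ Finset.range k := fun a ha => by simpa using hY (ht ha)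
  have hx := h (fun j => if (j : ℕ) ∈ t then g j else 0) ?_ ?_
  · have := congrFun hx ⟨i, by simpa using htk hi⟩
    simpa [hi] using this
  · rw [Fin.sum_univ_eq_sum_range (fun j => (if j ∈ t then g j else 0) • v j) k, ← hsum,
      ← Finset.sum_subset htk]
    · exact Finset.sum_congr rfl fun a ha => by rw [if_pos ha]
    · intro a _ ha; simp [ha]
  · refine le_trans ?_ hs
    rw [Set.ncard_eq_toFinset_card Y hYf, hammingNorm]
    refine Finset.card_le_card_of_injOn Fin.val ?_ Fin.val_injective.injOn
    intro a ha
    simp only [Finset.coe_filter, Finset.mem_univ, true_and, Set.mem_ofPred_eq, ne_eq,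
      ite_eq_right_iff, Classical.not_imp] at ha
    simpa using ht ha.1

theorem dotProduct_eq_zero_of_mem_span {φ : Fin n → F} {S : Set ℕ}
    (h : ∀ j ∈ S, φ ⬝ᵥ v j = 0) {x : Fin n → F} (hx : x ∈ Submodule.span F (v '' S)) :
    φ ⬝ᵥ x = 0 := by
  have : Submodule.span F (v '' S) ≤ LinearMap.ker (dotProductBilin F F φ) := by
    rw [Submodule.span_le]
    rintro _ ⟨j, hj, rfl⟩
    simpa using h j hj
  simpa using this hx

theorem exists_dotProduct_eq_zero_of_colRank_lt {S : Set ℕ} (h : colRank v S < n) :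
    ∃ φ : Fin n → F, φ ≠ 0 ∧ ∀ j ∈ S, φ ⬝ᵥ v j = 0 := by
  have hlt : Submodule.span F (v '' S) < ⊤ := by
    refine lt_top_iff_ne_top.2 fun htop => h.ne ?_
    rw [colRank, Set.finrank, htop]
    simp
  obtain ⟨f, hf, hle⟩ := Submodule.exists_le_ker_of_lt_top _ hlt
  obtain ⟨φ, rfl⟩ := (dotProductEquiv F (Fin n)).surjective f
  exact ⟨φ, by simpa using hf, fun j hj => hle (Submodule.subset_span ⟨j, hj, rfl⟩)⟩

/-- Each side of a vertical separation lies in a hyperplane, so a separation would cover the columns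
by two hyperplanes. -/
theorem kappa_eq_top_of_forall_exists
    (h : ∀ φ ψ : Fin n → F, φ ≠ 0 → ψ ≠ 0 → ∃ j < m, φ ⬝ᵥ v j ≠ 0 ∧ ψ ⬝ᵥ v j ≠ 0) :
    kappa v m = ⊤ := by
  by_contra! hne
  obtain ⟨k, -, X, Y, hP, hX, hY, -⟩ := exists_isPartition_of_kappa_lt (lt_top_iff_ne_top.2 hne)
  obtain ⟨φ, hφ, hφX⟩ :=
    exists_dotProduct_eq_zero_of_colRank_lt (hX.trans_le (colRank_le _))
  obtain ⟨ψ, hψ, hψY⟩ :=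
    exists_dotProduct_eq_zero_of_colRank_lt (hY.trans_le (colRank_le _))
  obtain ⟨j, hj, h1, h2⟩ := h φ ψ hφ hψ
  have : j ∈ X ∪ Y := hP.1 ▸ hj
  exact this.elim (fun hjX => h1 (hφX j hjX)) fun hjY => h2 (hψY j hjY)

/-- The typical behaviour of the columns near the time at which they span the space: the first
`n - w` of them are independent, the first `n + w` of them span the space, and one of the first
`n - w` columns is a coloop among the first `n + w`. -/
structure IsTypical [DecidableEq F] (v : ℕ → Fin n → F) (w : ℕ) : Prop where
  indep : NoShortRelation v (n - w) (n - w)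
  span : ∀ φ : Fin n → F, (∀ j < n + w, φ ⬝ᵥ v j = 0) → φ = 0
  coloop : ∃ φ : Fin n → F, ∃ i < n - w, ∀ j < n + w, φ ⬝ᵥ v j = if j = i then 1 else 0

variable [DecidableEq F]

theorem NoShortRelation.colRank_Iio (h : NoShortRelation v k k) (hm : m ≤ k) :
    colRank v (Set.Iio m) = m := by
  have hc : (Set.Iio m).ncard = m := by simp [Set.ncard_eq_toFinset_card']
  rw [colRank_eq_ncard (h.linearIndepOn (Set.Iio_subset_Iio hm) (by omega)), hc]

theorem NoShortRelation.min_le_colRank_Iio (h : NoShortRelation v k k) :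
    min m k ≤ colRank v (Set.Iio m) := by
  rw [← h.colRank_Iio (min_le_right m k)]
  exact colRank_mono (Set.Iio_subset_Iio (min_le_left m k))

theorem IsTypical.colRank_Iio (h : IsTypical v w) (hm : n + w ≤ m) :
    colRank v (Set.Iio m) = n := by
  refine (colRank_le _).antisymm (not_lt.1 fun hlt => ?_)
  obtain ⟨φ, hφ, hφ'⟩ := exists_dotProduct_eq_zero_of_colRank_lt hlt
  exact hφ (h.span φ fun j hj => hφ' j (by simp; omega))

theorem IsTypical.kappa_eq_one (h : IsTypical v w) (hw : 2 ≤ n - w) (hm : 2 ≤ m)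
    (hm' : m ≤ n + w) : kappa v m = 1 := by
  have hr : 2 ≤ colRank v (Set.Iio m) := le_trans (by simp [hm, hw]) h.indep.min_le_colRank_Iio
  rcases le_or_gt m (n - w) with hle | hgt
  · refine RandomMatroid.kappa_eq_one (j := 0) (by omega) hr ?_
    rw [h.indep.colRank_Iio hle]
    refine (colRank_le_ncard ((Set.finite_Iio m).subset Set.sdiff_subset)).trans_lt ?_
    rw [Set.ncard_sdiff (by simp; omega)]
    simp [Set.ncard_eq_toFinset_card']
    omega
  -- The functional vanishes on every column but the `i`-th, so `i` remains a coloop among any first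
  -- `m` columns with i < m ≤ n + w.
  · obtain ⟨φ, i, hi, hφ⟩ := h.coloop
    refine RandomMatroid.kappa_eq_one (j := i) (by omega) hr ?_
    refine Submodule.finrank_lt_finrank_of_lt (lt_of_le_not_ge
      (Submodule.span_mono (Set.image_mono Set.sdiff_subset)) fun hle => ?_)
    have hmem : v i ∈ Submodule.span F (v '' (Set.Iio m \ {i})) :=
      hle (Submodule.subset_span ⟨i, by simp; omega, rfl⟩)
    have h0 := dotProduct_eq_zero_of_mem_span (φ := φ) (fun j hj => by
      rw [hφ j (lt_of_lt_of_le hj.1 hm'), if_neg (by simpa using hj.2)]) hmem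
    rw [hφ i (by omega), if_pos rfl] at h0
    exact one_ne_zero h0

theorem IsTypical.kappa_mono (h : IsTypical v w) (hw : 2 ≤ n - w) {m' : ℕ} (hm : 2 ≤ m)
    (hmm' : m ≤ m') : kappa v m ≤ kappa v m' := by
  rcases le_total m (n + w) with hle | hle
  · rw [h.kappa_eq_one hw hm hle]
    exact one_le_kappa
  · exact RandomMatroid.kappa_mono hmm' (by
      rw [h.colRank_Iio hle, h.colRank_Iio (hle.trans hmm')])

theorem NoShortRelation.tutte_eq_kappa (h : NoShortRelation v (n - w) (n - w))
    (h' : NoShortRelation v (2 * n) s) {d : ℕ} (hm : 2 ≤ m) (hmd : m ≤ n + d)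
    (hs : d + w + 1 ≤ s) (hn : 2 * w + d + 1 < n) : tutte v m = kappa v m := by
  have hr := h.min_le_colRank_Iio (m := m)
  have hr' : colRank v (Set.Iio m) ≤ m := by
    simpa [Set.ncard_eq_toFinset_card'] using colRank_le_ncard (v := v) (Set.finite_Iio m)
  obtain ⟨r, hr1⟩ : ∃ r, colRank v (Set.Iio m) = r + 1 :=
    ⟨colRank v (Set.Iio m) - 1, by omega⟩
  -- The rank r + 1 is at least min m (n - w), so κ ≤ m - r ≤ d + w + 1 ≤ s.
  refine tutte_eq_kappa_of_linearIndepOn (s := s)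
    (fun Y hY hYs => h'.linearIndepOn (hY.trans (Set.Iio_subset_Iio (by omega))) hYs)
    ((kappa_le_of_colRank hr1 (by omega)).trans ?_)
  norm_cast
  omega

theorem IsTypical.exists_threshold (h : IsTypical v w) (hw : 2 ≤ n - w) (hm : 2 * n + 2 ≤ m)
    (htop : kappa v m = ⊤) : ∃ mhat : ℕ, n ≤ mhat ∧ mhat ≤ m ∧
      (∀ m : ℕ, 1 ≤ m → m < mhat → tutte v m = kappa v m) ∧
      (∀ m : ℕ, mhat ≤ m → tutte v m < kappa v m) := by
  classical
  have hex : ∃ m, tutte v m < kappa v m := ⟨m, by rw [htop]; exact tutte_lt_top hm⟩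
  have hspec := Nat.find_spec hex
  have hn : n + w < Nat.find hex := by
    by_contra! hle
    -- With fewer than two columns there are no two disjoint nonempty sides; from two columns on, κ
    -- = 1 ≤ t.
    rcases lt_or_ge (Nat.find hex) 2 with h2 | h2
    · obtain ⟨k, -, hk, X, Y, hP, hX, hY, -, -⟩ := exists_isPartition_of_tutte_lt_kappa hspec
      obtain ⟨a, ha⟩ := Set.nonempty_of_ncard_ne_zero (s := X) (by omega)
      obtain ⟨b, hb⟩ := Set.nonempty_of_ncard_ne_zero (s := Y) (by omega)
      have ha' := hP.left_subset ha
      have hb' := hP.right_subset hb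
      simp only [Set.mem_Iio] at ha' hb'
      obtain rfl : a = b := by omega
      exact Set.disjoint_left.1 hP.2 ha hb
    · rw [h.kappa_eq_one hw h2 hle] at hspec
      exact absurd hspec (not_lt.2 one_le_tutte)
  refine ⟨Nat.find hex, by omega, Nat.find_min' hex (by rw [htop]; exact tutte_lt_top hm),
    fun k _ hk => tutte_le_kappa.antisymm (not_lt.1 (Nat.find_min hex hk)), fun k hk => ?_⟩
  induction k, hk using Nat.le_induction with
  | base => exact hspec
  | succ k hk ih =>
    exact tutte_lt_kappa_succ (by rw [h.colRank_Iio (by omega), h.colRank_Iio (by omega)]) ih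

end Deterministic

/-! ### Probabilities of events -/

section Probability

/-- The second moment bound for finitely many events of the same probability which are pairwise
nonpositively correlated. -/
theorem measureReal_compl_iUnion_mul_le {Ω ι : Type*} [MeasurableSpace Ω] {P : Measure Ω}
    [IsProbabilityMeasure P] [Fintype ι] {E : ι → Set Ω} (hE : ∀ a, MeasurableSet (E a)) {p : ℝ}
    (hp : ∀ a, P.real (E a) = p) (hpair : ∀ a b, a ≠ b → P.real (E a ∩ E b) ≤ p ^ 2) (hp0 : 0 ≤ p) :
    P.real (⋃ a, E a)ᶜ * (Fintype.card ι * p) ≤ 1 := by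
  classical
  set N : ℝ := (Fintype.card ι : ℝ) with hNdef
  have hN : 0 ≤ N := Nat.cast_nonneg _
  rcases (mul_nonneg hN hp0).eq_or_lt with h0 | hpos
  · rw [← h0, mul_zero]; exact zero_le_one
  let Z : Ω → ℝ := fun ω => ∑ a, (E a).indicator 1 ω
  have hint : ∀ S : Set Ω, MeasurableSet S → Integrable (S.indicator (1 : Ω → ℝ)) P := fun S hS =>
    (integrable_const (1 : ℝ)).indicator hS
  have hZint : Integrable Z P := integrable_finsetSum _ fun a _ => hint _ (hE a)
  have hZ : ∫ ω, Z ω ∂P = N * p := by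
    rw [integral_finsetSum _ fun a _ => hint _ (hE a)]
    simp [integral_indicator_one, hE, hp, hNdef]
  have hsq : ∀ ω, Z ω ^ 2 = ∑ a, ∑ b, (E a ∩ E b).indicator (1 : Ω → ℝ) ω := fun ω => by
    rw [pow_two, Finset.sum_mul_sum]
    simp_rw [Set.inter_indicator_one]
    rfl
  have hZ2int : Integrable (fun ω => Z ω ^ 2) P := by
    simp_rw [hsq]
    exact integrable_finsetSum _ fun a _ => integrable_finsetSum _ fun b _ =>
      hint _ ((hE a).inter (hE b))
  have hZ2 : ∫ ω, Z ω ^ 2 ∂P ≤ N * p + N ^ 2 * p ^ 2 := by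
    simp_rw [hsq]
    rw [integral_finsetSum _ fun a _ => integrable_finsetSum _ fun b _ =>
      hint _ ((hE a).inter (hE b))]
    have hrow : ∀ a, ∫ ω, ∑ b, (E a ∩ E b).indicator (1 : Ω → ℝ) ω ∂P ≤ p + N * p ^ 2 := by
      intro a
      rw [integral_finsetSum _ fun b _ => hint _ ((hE a).inter (hE b))]
      calc ∑ b, ∫ ω, (E a ∩ E b).indicator (1 : Ω → ℝ) ω ∂P
          ≤ ∑ b, ((if b = a then p else 0) + p ^ 2) := by
            refine Finset.sum_le_sum fun b _ => ?_
            rw [integral_indicator_one ((hE a).inter (hE b))]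
            by_cases h : b = a
            · subst h
              rw [Set.inter_self, hp, if_pos rfl]
              exact le_add_of_nonneg_right (sq_nonneg p)
            · rw [if_neg h, zero_add]
              exact hpair a b (Ne.symm h)
        _ = p + N * p ^ 2 := by simp [Finset.sum_add_distrib, hNdef]
    refine (Finset.sum_le_sum fun a _ => hrow a).trans_eq ?_
    simp [hNdef]; ring
  have hmeas : MeasurableSet (⋃ a, E a)ᶜ := (MeasurableSet.iUnion hE).compl
  -- Chebyshev's argument: `Z` counts the events that occur and has mean N p. Off the union Z = 0,
  -- so (Z - N p)² = (N p)², while the variance is at most N p.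
  have hvar : P.real (⋃ a, E a)ᶜ * (N * p) ^ 2 ≤ N * p := by
    have hle : ∫ ω, (⋃ a, E a)ᶜ.indicator (1 : Ω → ℝ) ω * (N * p) ^ 2 ∂P
        ≤ ∫ ω, (Z ω ^ 2 - 2 * (N * p) * Z ω + (N * p) ^ 2) ∂P := by
      refine integral_mono ((hint _ hmeas).mul_const _)
        ((hZ2int.sub (hZint.const_mul _)).add (integrable_const _)) fun ω => ?_
      by_cases hω : ω ∈ (⋃ a, E a)ᶜ
      · have hZ0 : Z ω = 0 := Finset.sum_eq_zero fun a _ =>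
          Set.indicator_of_notMem (fun h => hω (Set.mem_iUnion.2 ⟨a, h⟩)) _
        rw [Set.indicator_of_mem hω, hZ0]
        simp
      · rw [Set.indicator_of_notMem hω]
        nlinarith [sq_nonneg (Z ω - N * p)]
    have hint2 : Integrable (fun ω => 2 * (N * p) * Z ω) P := hZint.const_mul _
    have hsub : Integrable (fun ω => Z ω ^ 2 - 2 * (N * p) * Z ω) P := hZ2int.sub hint2
    rw [integral_mul_const, integral_indicator_one hmeas, integral_add hsub (integrable_const _),
      integral_sub hZ2int hint2, integral_const_mul, hZ] at hle
    simp only [integral_const, probReal_univ, one_smul] at hle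
    nlinarith
  nlinarith

theorem measurableSet_of_fin {F α : Type*} [Finite F] [MeasurableSpace F]
    [MeasurableSingletonClass F] [Finite α] (S : Set (α → F)) : MeasurableSet S :=
  (Set.toFinite S).measurableSet

theorem measurableSet_forall_lt {F : Type*} [Finite F] [MeasurableSpace F]
    [MeasurableSingletonClass F] {n : ℕ} (m : ℕ) (t : ℕ → Set (Fin n → F)) :
    MeasurableSet {v : ℕ → Fin n → F | ∀ j < m, v j ∈ t j} := by
  have hset : {v : ℕ → Fin n → F | ∀ j < m, v j ∈ t j} = (Finset.range m : Set ℕ).pi t := by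
    ext v; simp [Set.mem_pi]
  rw [hset]
  exact MeasurableSet.pi (Finset.countable_toSet _) fun j _ => measurableSet_of_fin _

theorem exists_dotProduct_ne_zero {F : Type*} [Field F] {n : ℕ} {φ : Fin n → F} (hφ : φ ≠ 0) :
    ∃ x, φ ⬝ᵥ x ≠ 0 := by
  by_contra! h
  exact hφ (dotProduct_eq_zero φ h)

variable {F : Type*} [Field F] [Fintype F]

theorem one_lt_card_real : (1 : ℝ) < Fintype.card F := by exact_mod_cast Fintype.one_lt_card

variable [MeasurableSpace F] {n m k : ℕ}

/-- The law of one column. -/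
noncomputable def unif (F : Type*) [Field F] [Fintype F] [MeasurableSpace F] (n : ℕ) :
    Measure (Fin n → F) := (PMF.uniformOfFintype (Fin n → F)).toMeasure

instance : IsProbabilityMeasure (unif F n) := by unfold unif; infer_instance

instance : IsProbabilityMeasure (columnLaw F n) := by unfold columnLaw; infer_instance

theorem columnLaw_eq : columnLaw F n = Measure.infinitePi (fun _ : ℕ => unif F n) := rfl

variable [MeasurableSingletonClass F]

theorem unif_real (S : Set (Fin n → F)) :
    (unif F n).real S = (S.ncard : ℝ) / (Fintype.card F : ℝ) ^ n := by
  classical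
  rw [Measure.real, unif, PMF.toMeasure_uniformOfFintype_apply _ (measurableSet_of_fin S),
    ENNReal.toReal_div, Set.ncard_eq_toFinset_card', Set.toFinset_card]
  simp

theorem ncard_fiber_eq {V W : Type*} [AddCommGroup V] [Fintype V] [AddCommGroup W] (L : V →+ W)
    (x₀ : V) : {x | L x = L x₀}.ncard = {x | L x = 0}.ncard := by
  have : {x | L x = L x₀} = (fun x => x + x₀) '' {x | L x = 0} := by
    ext x
    constructor
    · intro hx
      exact ⟨x - x₀, by simpa [sub_eq_zero] using hx, sub_add_cancel _ _⟩
    · rintro ⟨y, hy, rfl⟩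
      simpa using hy
  rw [this, Set.ncard_image_of_injective _ (add_left_injective x₀)]

theorem sum_ncard_fiber {V W : Type*} [Fintype V] [Fintype W] (L : V → W) :
    ∑ w, {x | L x = w}.ncard = Fintype.card V := by
  classical
  rw [← Finset.card_univ, Finset.card_eq_sum_card_fiberwise (f := L) (t := Finset.univ)
    (fun _ _ => by simp)]
  refine Finset.sum_congr rfl fun w _ => ?_
  rw [Set.ncard_eq_toFinset_card']
  congr 1; ext; simp

/-- The nonempty fibres are cosets of the kernel, so they have equal size, and there are at most |W|
of them. -/
theorem inv_card_le_unif_fiber {W : Type*} [AddCommGroup W] [Fintype W] (L : (Fin n → F) →+ W)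
    (x₀ : Fin n → F) : (Fintype.card W : ℝ)⁻¹ ≤ (unif F n).real {x | L x = L x₀} := by
  have h : Fintype.card (Fin n → F) ≤ Fintype.card W * {x | L x = L x₀}.ncard := by
    rw [← sum_ncard_fiber L, ncard_fiber_eq, ← Finset.card_univ, ← smul_eq_mul, ← Finset.sum_const]
    refine Finset.sum_le_sum fun w _ => ?_
    by_cases hw : ∃ x, L x = w
    · obtain ⟨x, rfl⟩ := hw
      rw [ncard_fiber_eq]
    · have : {x | L x = w} = ∅ := Set.eq_empty_of_forall_notMem fun x hx => hw ⟨x, hx⟩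
      simp [this]
  have h' : (Fintype.card F : ℝ) ^ n ≤ Fintype.card W * ({x | L x = L x₀}.ncard : ℝ) := by
    rw [Fintype.card_fun, Fintype.card_fin] at h
    exact_mod_cast h
  have hW : (0 : ℝ) < Fintype.card W := by exact_mod_cast Fintype.card_pos
  have hF : (0 : ℝ) < (Fintype.card F : ℝ) ^ n := pow_pos (one_pos.trans one_lt_card_real) n
  rw [unif_real, le_div_iff₀ hF, inv_mul_le_iff₀ hW]
  exact h'

theorem unif_fiber_of_surjective {W : Type*} [AddCommGroup W] [Fintype W]
    (L : (Fin n → F) →+ W) (hL : Function.Surjective L) (a : W) :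
    (unif F n).real {x | L x = a} = (Fintype.card W : ℝ)⁻¹ := by
  have h : Fintype.card (Fin n → F) = Fintype.card W * {x | L x = a}.ncard := by
    rw [← sum_ncard_fiber L, ← Finset.card_univ, ← smul_eq_mul, ← Finset.sum_const]
    refine Finset.sum_congr rfl fun w _ => ?_
    obtain ⟨x, rfl⟩ := hL w
    obtain ⟨y, rfl⟩ := hL a
    rw [ncard_fiber_eq, ncard_fiber_eq]
  have h' : (Fintype.card F : ℝ) ^ n = Fintype.card W * ({x | L x = a}.ncard : ℝ) := by
    rw [Fintype.card_fun, Fintype.card_fin] at h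
    exact_mod_cast h
  have hW : (0 : ℝ) < Fintype.card W := by exact_mod_cast Fintype.card_pos
  have hF : (0 : ℝ) < (Fintype.card F : ℝ) ^ n := pow_pos (one_pos.trans one_lt_card_real) n
  rw [unif_real, div_eq_iff hF.ne', h', inv_mul_cancel_left₀ hW.ne']

theorem columnLaw_real_forall_lt (m : ℕ) (t : ℕ → Set (Fin n → F)) :
    (columnLaw F n).real {v | ∀ j < m, v j ∈ t j} = ∏ j ∈ Finset.range m, (unif F n).real (t j) := by
  have := Measure.infinitePi_pi (μ := fun _ : ℕ => unif F n) (s := Finset.range m) (t := t)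
    (fun j _ => measurableSet_of_fin _)
  have hset : {v : ℕ → Fin n → F | ∀ j < m, v j ∈ t j} = (Finset.range m : Set ℕ).pi t := by
    ext v; simp [Set.mem_pi]
  rw [hset, Measure.real, columnLaw_eq, this, ENNReal.toReal_prod]
  rfl

/-- The values of a nonzero functional at the columns are uniform. -/
theorem columnLaw_real_dotProduct_eq {φ : Fin n → F} (hφ : φ ≠ 0) (m : ℕ) (a : ℕ → F) :
    (columnLaw F n).real {v | ∀ j < m, φ ⬝ᵥ v j = a j} = ((Fintype.card F : ℝ) ^ m)⁻¹ := by
  refine (columnLaw_real_forall_lt m fun j => {x | φ ⬝ᵥ x = a j}).trans ?_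
  have hsurj : Function.Surjective (dotProductBilin F F φ).toAddMonoidHom := fun c => by
    obtain ⟨x, hx⟩ := exists_dotProduct_ne_zero hφ
    exact ⟨(c / (φ ⬝ᵥ x)) • x, by simp [dotProductBilin, hx]⟩
  have h : ∀ j, (unif F n).real {x | φ ⬝ᵥ x = a j} = (Fintype.card F : ℝ)⁻¹ := fun j =>
    unif_fiber_of_surjective _ hsurj (a j)
  simp [h]

/-- The values of two independent functionals at the columns are independent and uniform. -/
theorem columnLaw_real_dotProduct_eq_and {φ ψ : Fin n → F} (hφ : φ ≠ 0)
    (hψ : ∀ c : F, c • φ ≠ ψ) (m : ℕ) (a b : ℕ → F) :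
    (columnLaw F n).real {v | ∀ j < m, φ ⬝ᵥ v j = a j ∧ ψ ⬝ᵥ v j = b j}
      = (((Fintype.card F : ℝ) ^ m)⁻¹) ^ 2 := by
  refine (columnLaw_real_forall_lt m fun j => {x | φ ⬝ᵥ x = a j ∧ ψ ⬝ᵥ x = b j}).trans ?_
  obtain ⟨x, hx⟩ := exists_dotProduct_ne_zero hφ
  -- If ψ vanished on the kernel of φ, it would be a multiple of φ.
  obtain ⟨y, hy0, hy⟩ : ∃ y, φ ⬝ᵥ y = 0 ∧ ψ ⬝ᵥ y ≠ 0 := by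
    by_contra! h
    refine hψ ((ψ ⬝ᵥ x) / (φ ⬝ᵥ x)) (dotProduct_eq _ _ fun z => ?_)
    have := h (z - ((φ ⬝ᵥ z) / (φ ⬝ᵥ x)) • x) (by simp [dotProduct_sub, hx])
    rw [dotProduct_sub, dotProduct_smul, smul_eq_mul, sub_eq_zero] at this
    rw [this, smul_dotProduct, smul_eq_mul]
    ring
  have hsurj : Function.Surjective
      ((dotProductBilin F F φ).prod (dotProductBilin F F ψ)).toAddMonoidHom := fun c => by
    refine ⟨(c.1 / (φ ⬝ᵥ x)) • x + ((c.2 - c.1 / (φ ⬝ᵥ x) * (ψ ⬝ᵥ x)) / (ψ ⬝ᵥ y)) • y, ?_⟩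
    ext <;> simp [dotProductBilin, dotProduct_add, hx, hy0, hy]
  have h : ∀ j, (unif F n).real {x | φ ⬝ᵥ x = a j ∧ ψ ⬝ᵥ x = b j}
      = ((Fintype.card F : ℝ)⁻¹) ^ 2 := fun j => by
    have := unif_fiber_of_surjective _ hsurj (a j, b j)
    simp only [Fintype.card_prod, Nat.cast_mul] at this
    rw [inv_pow, pow_two, ← this]
    congr 1
    ext z
    simp [dotProductBilin]
  simp [h, ← pow_mul, mul_comm]

theorem columnLaw_real_dotProduct_eq_zero_or_le {φ ψ : Fin n → F} (hφ : φ ≠ 0) (hψ : ψ ≠ 0)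
    (m : ℕ) : (columnLaw F n).real {v | ∀ j < m, φ ⬝ᵥ v j = 0 ∨ ψ ⬝ᵥ v j = 0}
      ≤ (1 - ((Fintype.card F : ℝ) ^ 2)⁻¹) ^ m := by
  refine (columnLaw_real_forall_lt m fun _ => {x | φ ⬝ᵥ x = 0 ∨ ψ ⬝ᵥ x = 0}).trans_le ?_
  rw [Finset.prod_const, Finset.card_range]
  refine pow_le_pow_left₀ measureReal_nonneg ?_ m
  -- The space is not a union of two hyperplanes. The fibre of (φ, ψ) through `z` has probability at
  -- least q^(-2), even when φ and ψ are proportional.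
  obtain ⟨z, hz1, hz2⟩ : ∃ z, φ ⬝ᵥ z ≠ 0 ∧ ψ ⬝ᵥ z ≠ 0 := by
    obtain ⟨x, hx⟩ := exists_dotProduct_ne_zero hφ
    obtain ⟨y, hy⟩ := exists_dotProduct_ne_zero hψ
    by_cases h1 : ψ ⬝ᵥ x = 0
    · by_cases h2 : φ ⬝ᵥ y = 0
      · exact ⟨x + y, by simp [dotProduct_add, h2, hx], by simp [dotProduct_add, h1, hy]⟩
      · exact ⟨y, h2, hy⟩
    · exact ⟨x, hx, h1⟩
  have h := inv_card_le_unif_fiber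
    ((dotProductBilin F F φ).prod (dotProductBilin F F ψ)).toAddMonoidHom z
  simp only [Fintype.card_prod, Nat.cast_mul] at h
  have hsub : {x : Fin n → F | ((dotProductBilin F F φ).prod (dotProductBilin F F ψ)).toAddMonoidHom x
      = ((dotProductBilin F F φ).prod (dotProductBilin F F ψ)).toAddMonoidHom z}
      ⊆ {x | φ ⬝ᵥ x = 0 ∨ ψ ⬝ᵥ x = 0}ᶜ := by
    intro x hx
    have h1 : φ ⬝ᵥ x = φ ⬝ᵥ z := congrArg Prod.fst hx
    have h2 : ψ ⬝ᵥ x = ψ ⬝ᵥ z := congrArg Prod.snd hx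
    simp [h1, h2, hz1, hz2]
  have h2 := h.trans (measureReal_mono hsub)
  rw [probReal_compl_eq_one_sub (measurableSet_of_fin _)] at h2
  rw [pow_two]
  linarith

/-- A nontrivial linear relation holds with probability `q ^ (-n)`. -/
theorem columnLaw_real_sum_smul_eq_zero_le {x : Fin k → F} (hx : x ≠ 0) :
    (columnLaw F n).real {v | ∑ j, x j • v j = 0} ≤ ((Fintype.card F : ℝ) ^ n)⁻¹ := by
  obtain ⟨i, hi⟩ := Function.ne_iff.1 hx
  have hD : ∀ u : Fin n → F, MeasurableSet {v : ℕ → Fin n → F | ∑ j, x j • v j = u} := fun u => by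
    have hrestr : Measurable fun (v : ℕ → Fin n → F) (j : Fin k) => v j :=
      measurable_pi_lambda _ fun j => measurable_pi_apply _
    exact hrestr (t := {y | ∑ j, x j • y j = u}) (Set.toFinite _).measurableSet
  -- Translating the `i`-th column by -(x i)⁻¹ u preserves the law and shifts the sum by -u, so all
  -- q^n values of the sum are equally likely.
  have hshift : ∀ u : Fin n → F, (columnLaw F n).real {v | ∑ j, x j • v j = u}
      = (columnLaw F n).real {v | ∑ j, x j • v j = 0} := fun u => by
    let f : ℕ → (Fin n → F) → (Fin n → F) := fun j y =>
      if j = i then y - (x i)⁻¹ • u else y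
    have hf : ∀ j, Function.Bijective (f j) := fun j => by
      by_cases h : j = i
      · simp only [f, h, if_true]
        exact (Equiv.subRight ((x i)⁻¹ • u)).bijective
      · simp only [f, h, if_false]
        exact Function.bijective_id
    have hfm : ∀ j, Measurable (f j) := fun j => measurable_of_finite _
    have hmap : ∀ j, (unif F n).map (f j) = unif F n := fun j => by
      ext S -
      rw [Measure.map_apply (hfm j) (measurableSet_of_fin S),
        ← ENNReal.toReal_eq_toReal_iff' (measure_ne_top _ _) (measure_ne_top _ _)]
      change (unif F n).real _ = (unif F n).real _
      rw [unif_real, unif_real, Set.ncard_preimage_of_injective_subset_range (hf j).1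
        (by rw [(hf j).2.range_eq]; exact Set.subset_univ _)]
    have hmp : (columnLaw F n).map (fun v j => f j (v j)) = columnLaw F n := by
      rw [columnLaw_eq, Measure.infinitePi_map_pi _ hfm]
      simp_rw [hmap]
    conv_rhs => rw [← hmp]
    have hfm' : Measurable fun (v : ℕ → Fin n → F) j => f j (v j) :=
      measurable_pi_lambda _ fun j => (hfm j).comp (measurable_pi_apply j)
    rw [map_measureReal_apply hfm' (hD 0)]
    congr 1
    ext v
    have : ∑ j, x j • f j (v j) = ∑ j, x j • v j - u := by
      have hterm : ∀ j : Fin k, x j • f j (v j) = x j • v j - if j = i then u else 0 := by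
        intro j
        by_cases h : j = i
        · subst h
          simp [f, smul_sub, smul_smul, mul_inv_cancel₀ hi]
        · have : (j : ℕ) ≠ i := fun h' => h (Fin.ext h')
          simp [f, this, h]
      simp [hterm, Finset.sum_sub_distrib]
    simp [this, sub_eq_zero]
  have hsum : ∑ u : Fin n → F, (columnLaw F n).real {v | ∑ j, x j • v j = u} ≤ 1 := by
    rw [← measureReal_iUnion_fintype _ hD]
    · exact measureReal_le_one
    · intro a b hab
      exact Set.disjoint_left.2 fun v hv hv' => hab (hv.symm.trans hv')
  rw [Finset.sum_congr rfl fun u _ => hshift u] at hsum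
  simp only [Finset.sum_const, Finset.card_univ, Fintype.card_fun, Fintype.card_fin, nsmul_eq_mul,
    Nat.cast_pow] at hsum
  have hF : (0 : ℝ) < (Fintype.card F : ℝ) ^ n := pow_pos (one_pos.trans one_lt_card_real) n
  rw [← one_div, le_div_iff₀ hF, mul_comm]
  exact hsum

end Probability

/-! ### Events of high probability -/

section HighProbability

theorem measureReal_le_card_mul {Ω ι : Type*} [MeasurableSpace Ω] {P : Measure Ω}
    [IsFiniteMeasure P] {S : Set Ω} {T : Finset ι} {E : ι → Set Ω} {c : ℝ}
    (hS : S ⊆ ⋃ a ∈ T, E a) (h : ∀ a ∈ T, P.real (E a) ≤ c) : P.real S ≤ T.card * c := by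
  refine (measureReal_mono hS (measure_ne_top _ _)).trans
    ((measureReal_biUnion_finset_le _ _).trans ?_)
  rw [← nsmul_eq_mul]
  exact Finset.sum_le_card_nsmul T _ c h

/-- The number of vectors of small weight, bounded by means of the weight enumerator. -/
theorem card_filter_hammingNorm_le {F : Type*} [Field F] [Fintype F] [DecidableEq F]
    (k s : ℕ) {t : ℝ} (ht : 1 ≤ t) :
    ((Finset.univ.filter fun x : Fin k → F => hammingNorm x ≤ s).card : ℝ)
      ≤ t ^ s * (1 + Fintype.card F / t) ^ k := by
  have ht0 : 0 < t := one_pos.trans_le ht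
  have hprod : ∀ x : Fin k → F, ∏ j, (if x j = 0 then (1 : ℝ) else t⁻¹) = t⁻¹ ^ hammingNorm x := by
    intro x
    rw [Finset.prod_ite]
    simp [hammingNorm]
  have hsum : ∑ x : Fin k → F, t⁻¹ ^ hammingNorm x ≤ (1 + Fintype.card F / t) ^ k := by
    simp_rw [← hprod]
    rw [← Fintype.sum_pow (fun a : F => if a = 0 then (1 : ℝ) else t⁻¹)]
    refine pow_le_pow_left₀ (Finset.sum_nonneg fun a _ => by split_ifs <;> positivity) ?_ k
    calc ∑ a : F, (if a = 0 then (1 : ℝ) else t⁻¹)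
        ≤ ∑ a : F, ((if a = 0 then (1 : ℝ) else 0) + t⁻¹) := by
          refine Finset.sum_le_sum fun a _ => ?_
          split_ifs
          · linarith [inv_pos.2 ht0]
          · simp
      _ = 1 + Fintype.card F / t := by
          simp [Finset.sum_add_distrib, div_eq_mul_inv]
  calc ((Finset.univ.filter fun x : Fin k → F => hammingNorm x ≤ s).card : ℝ)
      = ∑ x ∈ Finset.univ.filter fun x : Fin k → F => hammingNorm x ≤ s, 1 := by simp
    _ ≤ ∑ x ∈ Finset.univ.filter fun x : Fin k → F => hammingNorm x ≤ s,
          t ^ s * t⁻¹ ^ hammingNorm x := by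
        refine Finset.sum_le_sum fun x hx => ?_
        rw [inv_pow, ← div_eq_mul_inv, one_le_div (pow_pos ht0 _)]
        exact pow_le_pow_right₀ ht (Finset.mem_filter.1 hx).2
    _ ≤ ∑ x : Fin k → F, t ^ s * t⁻¹ ^ hammingNorm x :=
        Finset.sum_le_univ_sum_of_nonneg fun x => by positivity
    _ ≤ t ^ s * (1 + Fintype.card F / t) ^ k := by
        rw [← Finset.mul_sum]
        exact mul_le_mul_of_nonneg_left hsum (by positivity)

variable {F : Type*} [Field F] [Fintype F] [MeasurableSpace F]

/-- The outer probability of the complement of `S n` tends to `0`. -/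
def HighProb (F : Type*) [Field F] [Fintype F] [MeasurableSpace F]
    (S : ∀ n : ℕ, Set (ℕ → Fin n → F)) : Prop :=
  Tendsto (fun n : ℕ => (columnLaw F n).real (S n)ᶜ) atTop (𝓝 0)

theorem HighProb.of_le {S : ∀ n : ℕ, Set (ℕ → Fin n → F)} {b : ℕ → ℝ}
    (hb : Tendsto b atTop (𝓝 0)) (h : ∀ᶠ n in atTop, (columnLaw F n).real (S n)ᶜ ≤ b n) :
    HighProb F S :=
  tendsto_of_tendsto_of_tendsto_of_le_of_le' tendsto_const_nhds hb
    (Eventually.of_forall fun _ => measureReal_nonneg) h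

theorem HighProb.mono {S T : ∀ n : ℕ, Set (ℕ → Fin n → F)} (hS : HighProb F S)
    (h : ∀ᶠ n in atTop, S n ⊆ T n) : HighProb F T :=
  HighProb.of_le hS (h.mono fun _ hn => measureReal_mono (Set.compl_subset_compl.2 hn))

theorem HighProb.inter {S T : ∀ n : ℕ, Set (ℕ → Fin n → F)} (hS : HighProb F S)
    (hT : HighProb F T) : HighProb F fun n => S n ∩ T n := by
  refine HighProb.of_le (by simpa using Tendsto.add hS hT) (Eventually.of_forall fun n => ?_)
  rw [Set.compl_inter]
  exact measureReal_union_le _ _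

/-- Only subadditivity of the outer measure is used, so the events need not be shown measurable. -/
theorem HighProb.aas {S : ∀ n : ℕ, Set (ℕ → Fin n → F)} (hS : HighProb F S) : AAS F S := by
  have h0 : Tendsto (fun n : ℕ => 1 - columnLaw F n (S n)ᶜ) atTop (𝓝 1) := by
    have h1 : Tendsto (fun n : ℕ => columnLaw F n (S n)ᶜ) atTop (𝓝 0) := by
      have := ENNReal.tendsto_ofReal hS
      simpa [ofReal_measureReal] using this
    simpa using ENNReal.Tendsto.sub tendsto_const_nhds h1 (Or.inl ENNReal.one_ne_top)
  refine tendsto_of_tendsto_of_tendsto_of_le_of_le h0 tendsto_const_nhds (fun n => ?_)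
    (fun n => prob_le_one)
  rw [tsub_le_iff_right, ← measure_univ (μ := columnLaw F n), ← Set.union_compl_self (S n)]
  exact measure_union_le _ _

variable [MeasurableSingletonClass F]

theorem columnLaw_real_compl_noShortRelation_le [DecidableEq F] (n k s : ℕ) :
    (columnLaw F n).real {v | NoShortRelation v k s}ᶜ
      ≤ (Finset.univ.filter fun x : Fin k → F => hammingNorm x ≤ s).card
        * ((Fintype.card F : ℝ) ^ n)⁻¹ := by
  let T := Finset.univ.filter fun x : Fin k → F => x ≠ 0 ∧ hammingNorm x ≤ s
  have hsub : {v : ℕ → Fin n → F | NoShortRelation v k s}ᶜ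
      ⊆ ⋃ x ∈ T, {v | ∑ j, x j • v j = 0} := by
    intro v hv
    simp only [NoShortRelation, Set.mem_compl_iff, Set.mem_ofPred_eq, not_forall] at hv
    obtain ⟨x, h1, h2, h3⟩ := hv
    exact Set.mem_biUnion (show x ∈ T by simp [T, h2, h3]) h1
  refine (measureReal_le_card_mul hsub fun x hx =>
    columnLaw_real_sum_smul_eq_zero_le (Finset.mem_filter.1 hx).2.1).trans ?_
  have hc : T.card ≤ (Finset.univ.filter fun x : Fin k → F => hammingNorm x ≤ s).card :=
    Finset.card_le_card fun x hx => by
      simp only [T, Finset.mem_filter] at hx ⊢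
      exact ⟨hx.1, hx.2.2⟩
  gcongr

theorem columnLaw_real_compl_span_le (n m : ℕ) :
    (columnLaw F n).real {v | ∀ φ : Fin n → F, (∀ j < m, φ ⬝ᵥ v j = 0) → φ = 0}ᶜ
      ≤ (Fintype.card F : ℝ) ^ n * ((Fintype.card F : ℝ) ^ m)⁻¹ := by
  classical
  have hsub : {v : ℕ → Fin n → F | ∀ φ : Fin n → F, (∀ j < m, φ ⬝ᵥ v j = 0) → φ = 0}ᶜ
      ⊆ ⋃ φ ∈ Finset.univ.filter fun φ : Fin n → F => φ ≠ 0, {v | ∀ j < m, φ ⬝ᵥ v j = 0} := by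
    intro v hv
    simp only [Set.mem_compl_iff, Set.mem_ofPred_eq, not_forall] at hv
    obtain ⟨φ, h1, h2⟩ := hv
    exact Set.mem_biUnion (by simpa using h2) h1
  refine (measureReal_le_card_mul hsub fun φ hφ =>
    (columnLaw_real_dotProduct_eq (Finset.mem_filter.1 hφ).2 m 0).le).trans ?_
  gcongr
  have := Finset.card_le_univ (Finset.univ.filter fun φ : Fin n → F => φ ≠ 0)
  rw [Fintype.card_fun, Fintype.card_fin] at this
  exact_mod_cast this

theorem columnLaw_real_compl_forall_exists_le (n m : ℕ) :
    (columnLaw F n).real {v | ∀ φ ψ : Fin n → F, φ ≠ 0 → ψ ≠ 0 →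
        ∃ j < m, φ ⬝ᵥ v j ≠ 0 ∧ ψ ⬝ᵥ v j ≠ 0}ᶜ
      ≤ ((Fintype.card F : ℝ) ^ n) ^ 2 * (1 - ((Fintype.card F : ℝ) ^ 2)⁻¹) ^ m := by
  classical
  let T := Finset.univ.filter fun φ : (Fin n → F) × (Fin n → F) => φ.1 ≠ 0 ∧ φ.2 ≠ 0
  have hsub : {v : ℕ → Fin n → F | ∀ φ ψ : Fin n → F, φ ≠ 0 → ψ ≠ 0 →
        ∃ j < m, φ ⬝ᵥ v j ≠ 0 ∧ ψ ⬝ᵥ v j ≠ 0}ᶜ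
      ⊆ ⋃ φ ∈ T, {v | ∀ j < m, φ.1 ⬝ᵥ v j = 0 ∨ φ.2 ⬝ᵥ v j = 0} := by
    intro v hv
    simp only [Set.mem_compl_iff, Set.mem_ofPred_eq, not_forall] at hv
    obtain ⟨φ, ψ, h1, h2, h3⟩ := hv
    refine Set.mem_biUnion (show (φ, ψ) ∈ T by simp [T, h1, h2]) fun j hj => ?_
    by_contra! h
    exact h3 ⟨j, hj, h⟩
  refine (measureReal_le_card_mul hsub fun φ hφ => columnLaw_real_dotProduct_eq_zero_or_le
    (Finset.mem_filter.1 hφ).2.1 (Finset.mem_filter.1 hφ).2.2 m).trans ?_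
  have h1 : ((Fintype.card F : ℝ) ^ 2)⁻¹ ≤ 1 :=
    inv_le_one_of_one_le₀ (one_le_pow₀ one_lt_card_real.le)
  have h2 : T.card ≤ (Fintype.card F ^ n) ^ 2 := by
    refine (Finset.card_le_univ T).trans_eq ?_
    simp [pow_two]
  refine mul_le_mul_of_nonneg_right (by exact_mod_cast h2) (pow_nonneg (by linarith) m)

/-- Second moment over pairs (φ, i), each of probability q^(-m). Nonproportional functionals give
independent events. Proportional ones give disjoint events: a value 1 at both marked columns, which
lie among the first `m`, forces equal indices and factor 1. -/
theorem columnLaw_real_compl_coloop_mul_le (n : ℕ) {k m : ℕ} (hkm : k ≤ m) :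
    (columnLaw F n).real {v | ∃ φ : Fin n → F, ∃ i < k,
        ∀ j < m, φ ⬝ᵥ v j = if j = i then 1 else 0}ᶜ
      * (((Fintype.card F : ℝ) ^ n - 1) * k * ((Fintype.card F : ℝ) ^ m)⁻¹) ≤ 1 := by
  classical
  let E : {φ : Fin n → F // φ ≠ 0} × Fin k → Set (ℕ → Fin n → F) := fun a =>
    {v | ∀ j < m, a.1.1 ⬝ᵥ v j = if j = a.2 then 1 else 0}
  have hE : ∀ a, MeasurableSet (E a) := fun a =>
    measurableSet_forall_lt m fun j => {x | a.1.1 ⬝ᵥ x = if j = a.2 then 1 else 0}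
  have hcard : (Fintype.card ({φ : Fin n → F // φ ≠ 0} × Fin k) : ℝ)
      = ((Fintype.card F : ℝ) ^ n - 1) * k := by
    rw [Fintype.card_prod, Fintype.card_subtype_compl]
    simp [Nat.cast_sub (Nat.one_le_pow _ _ (Fintype.card_pos (α := F)))]
  have h := measureReal_compl_iUnion_mul_le hE
    (fun a => columnLaw_real_dotProduct_eq a.1.2 m fun j => if j = a.2 then 1 else 0) ?_
    (by positivity)
  · rw [hcard] at h
    refine le_trans (mul_le_mul_of_nonneg_right (measureReal_mono
      (Set.compl_subset_compl.2 ?_)) ?_) h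
    · refine Set.iUnion_subset fun a v hv => ⟨a.1, a.2, a.2.2, hv⟩
    · have : (1 : ℝ) ≤ (Fintype.card F : ℝ) ^ n := one_le_pow₀ one_lt_card_real.le
      have : 0 ≤ (Fintype.card F : ℝ) ^ n - 1 := by linarith
      positivity
  · rintro ⟨⟨φ, hφ⟩, i⟩ ⟨⟨ψ, hψ⟩, i'⟩ hne
    by_cases hdep : ∃ c : F, c • φ = ψ
    · obtain ⟨c, rfl⟩ := hdep
      have hempty : E (⟨φ, hφ⟩, i) ∩ E (⟨c • φ, hψ⟩, i') = ∅ := by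
        refine Set.eq_empty_of_forall_notMem fun v hv => hne ?_
        have h1 := hv.1 i' (i'.2.trans_le hkm)
        have h2 := hv.2 i' (i'.2.trans_le hkm)
        simp only [smul_dotProduct, if_true, smul_eq_mul] at h1 h2
        have hii : (i' : ℕ) = i := by
          by_contra hii
          rw [h1, if_neg hii, mul_zero] at h2
          exact zero_ne_one h2
        rw [if_pos hii] at h1
        rw [h1, mul_one] at h2
        simp [h2, Fin.ext hii]
      rw [hempty, measureReal_empty]
      positivity
    · refine le_trans (le_of_eq ?_) (columnLaw_real_dotProduct_eq_and hφ (not_exists.1 hdep) m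
        (fun j => if j = i then 1 else 0) (fun j => if j = i' then 1 else 0)).le
      congr 1
      ext v
      simp only [E, Set.mem_inter_iff, Set.mem_ofPred_eq]
      exact ⟨fun h j hj => ⟨h.1 j hj, h.2 j hj⟩, fun h => ⟨fun j hj => (h j hj).1,
        fun j hj => (h j hj).2⟩⟩

end HighProbability

/-! ### Choice of the window and limits of the probability bounds -/

section Asymptotic

variable (F : Type*) [Fintype F]

/-- A slowly growing width of the window in which the first columns begin to span the space. -/
def window (n : ℕ) : ℕ := Nat.log (Fintype.card F ^ 2) n

theorem pow_window_le {n : ℕ} (hn : n ≠ 0) : (Fintype.card F ^ 2) ^ window F n ≤ n :=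
  Nat.pow_log_le_self _ hn

variable [Field F]

theorem one_lt_card_sq : 1 < Fintype.card F ^ 2 :=
  Nat.one_lt_pow two_ne_zero Fintype.one_lt_card

theorem tendsto_window : Tendsto (window F) atTop atTop :=
  tendsto_atTop.2 fun b => (eventually_ge_atTop ((Fintype.card F ^ 2) ^ b)).mono fun _ hn =>
    Nat.le_log_of_pow_le (one_lt_card_sq F) hn

theorem two_mul_window_le (n : ℕ) : 2 * window F n ≤ n := by
  rcases eq_or_ne n 0 with rfl | hn
  · simp [window]
  refine le_trans ?_ (pow_window_le F hn)
  rw [← pow_mul]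
  exact (Nat.lt_pow_self Fintype.one_lt_card).le

theorem tendsto_inv_pow_window :
    Tendsto (fun n => ((Fintype.card F : ℝ) ^ window F n)⁻¹) atTop (𝓝 0) := by
  simp_rw [← inv_pow]
  have hq : (1 : ℝ) < Fintype.card F := one_lt_card_real
  exact (tendsto_pow_atTop_nhds_zero_of_lt_one (by positivity)
    (inv_lt_one_of_one_lt₀ hq)).comp (tendsto_window F)

theorem eventually_two_le_sub_window : ∀ᶠ n in atTop, 2 ≤ n - window F n :=
  (eventually_ge_atTop 4).mono fun n hn => by
    have := two_mul_window_le F n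
    omega

/-- The window is of sublinear width. -/
theorem eventually_mul_window_le (K : ℕ) : ∀ᶠ n in atTop, K * window F n ≤ n := by
  filter_upwards [(tendsto_window F).eventually_ge_atTop K, eventually_ne_atTop 0] with n hK hn
  refine le_trans ?_ (pow_window_le F hn)
  calc K * window F n ≤ window F n * window F n := Nat.mul_le_mul_right _ hK
    _ ≤ Fintype.card F ^ window F n * Fintype.card F ^ window F n :=
        Nat.mul_le_mul (Nat.lt_pow_self Fintype.one_lt_card).le
          (Nat.lt_pow_self Fintype.one_lt_card).le
    _ = (Fintype.card F ^ 2) ^ window F n := by rw [← pow_mul]; ring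

variable [MeasurableSpace F] [MeasurableSingletonClass F]

theorem highProb_noShortRelation_sub_window [DecidableEq F] :
    HighProb F fun n => {v | NoShortRelation v (n - window F n) (n - window F n)} := by
  refine HighProb.of_le (tendsto_inv_pow_window F) (Eventually.of_forall fun n => ?_)
  refine (columnLaw_real_compl_noShortRelation_le n _ _).trans ?_
  have hw := two_mul_window_le F n
  have hq : (0 : ℝ) < Fintype.card F := one_pos.trans one_lt_card_real
  have h : ((Finset.univ.filter fun x : Fin (n - window F n) → F =>
      hammingNorm x ≤ n - window F n).card : ℝ) ≤ (Fintype.card F : ℝ) ^ (n - window F n) := by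
    refine le_trans (Nat.cast_le.2 (Finset.card_le_univ _)) ?_
    simp
  refine (mul_le_mul_of_nonneg_right h (by positivity)).trans_eq ?_
  rw [pow_sub₀ _ hq.ne' (by omega)]
  field_simp

theorem highProb_span :
    HighProb F fun n => {v | ∀ φ : Fin n → F, (∀ j < n + window F n, φ ⬝ᵥ v j = 0) → φ = 0} := by
  refine HighProb.of_le (tendsto_inv_pow_window F) (Eventually.of_forall fun n => ?_)
  refine (columnLaw_real_compl_span_le n _).trans_eq ?_
  have hq : (0 : ℝ) < Fintype.card F := one_pos.trans one_lt_card_real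
  rw [pow_add]
  field_simp

/-- The expected number of pairs (φ, i) is (q^n - 1)(n - w) q^(-n-w), which is at least q^w / 4
because q^(2w) ≤ n and 2w ≤ n. -/
theorem highProb_coloop :
    HighProb F fun n => {v | ∃ φ : Fin n → F, ∃ i < n - window F n,
        ∀ j < n + window F n, φ ⬝ᵥ v j = if j = i then 1 else 0} := by
  refine HighProb.of_le (by simpa using (tendsto_inv_pow_window F).const_mul 4)
    ((eventually_ge_atTop 1).mono fun n hn => ?_)
  have hmain := columnLaw_real_compl_coloop_mul_le (F := F) n
    (k := n - window F n) (m := n + window F n) (by omega)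
  set x := (columnLaw F n).real {v | ∃ φ : Fin n → F, ∃ i < n - window F n,
        ∀ j < n + window F n, φ ⬝ᵥ v j = if j = i then 1 else 0}ᶜ
  have hx : 0 ≤ x := measureReal_nonneg
  have hw := two_mul_window_le F n
  have hpw : ((Fintype.card F : ℝ) ^ window F n) ^ 2 ≤ n := by
    have := pow_window_le F (n := n) (by omega)
    rw [← pow_mul, mul_comm, pow_mul] at this
    exact_mod_cast this
  have hcast : ((n - window F n : ℕ) : ℝ) = n - window F n :=
    Nat.cast_sub (by omega)
  have hw' : 2 * (window F n : ℝ) ≤ n := by exact_mod_cast hw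
  have hq2 : (2 : ℝ) ≤ Fintype.card F := by exact_mod_cast Fintype.one_lt_card (α := F)
  have hqn : (2 : ℝ) ≤ (Fintype.card F : ℝ) ^ n :=
    hq2.trans (le_self_pow₀ (by linarith) (by omega))
  rw [hcast, pow_add] at hmain
  set a := (Fintype.card F : ℝ) ^ n
  set b := (Fintype.card F : ℝ) ^ window F n with hb
  have hb0 : 0 < b := pow_pos (by linarith) _
  have ha0 : 0 < a := by linarith
  have hge : b / 4 ≤ (a - 1) * (n - window F n) * (a * b)⁻¹ := by
    rw [← div_eq_mul_inv, le_div_iff₀ (by positivity)]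
    have h1 : a / 2 * (b ^ 2 / 2) ≤ (a - 1) * (n - window F n) :=
      mul_le_mul (by linarith) (by linarith) (by positivity) (by linarith)
    calc b / 4 * (a * b) = a / 2 * (b ^ 2 / 2) := by ring
      _ ≤ _ := h1
  have hxb : x * (b / 4) ≤ 1 := (mul_le_mul_of_nonneg_left hge hx).trans hmain
  rw [← div_eq_mul_inv, le_div_iff₀ hb0]
  linarith

theorem highProb_isTypical [DecidableEq F] :
    HighProb F fun n => {v : ℕ → Fin n → F | IsTypical v (window F n)} :=
  (((highProb_noShortRelation_sub_window F).inter (highProb_span F)).inter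
    (highProb_coloop F)).mono (Eventually.of_forall fun _ _ hv => ⟨hv.1.1, hv.1.2, hv.2⟩)

/-- A linear number of columns is with high probability not covered by two hyperplanes. -/
theorem exists_highProb_forall_exists : ∃ C : ℕ, 3 ≤ C ∧
    HighProb F fun n => {v | ∀ φ ψ : Fin n → F, φ ≠ 0 → ψ ≠ 0 →
      ∃ j < C * n, φ ⬝ᵥ v j ≠ 0 ∧ ψ ⬝ᵥ v j ≠ 0} := by
  have hq : (1 : ℝ) < Fintype.card F := one_lt_card_real
  set θ : ℝ := 1 - ((Fintype.card F : ℝ) ^ 2)⁻¹ with hθ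
  have h0 : 0 ≤ θ := sub_nonneg.2 (inv_le_one_of_one_le₀ (one_le_pow₀ hq.le))
  have h1 : θ < 1 := sub_lt_self _ (by positivity)
  have hlim : Tendsto (fun C : ℕ => (Fintype.card F : ℝ) ^ 2 * θ ^ C) atTop (𝓝 0) := by
    simpa using (tendsto_pow_atTop_nhds_zero_of_lt_one h0 h1).const_mul _
  -- The union bound over pairs of functionals is (q² θ^C)^n. The condition C ≥ 3 later gives C n ≥
  -- 2n + 2.
  obtain ⟨C, hC, hC3⟩ := ((hlim.eventually_lt_const one_pos).and (eventually_ge_atTop 3)).exists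
  refine ⟨C, hC3, HighProb.of_le
    (tendsto_pow_atTop_nhds_zero_of_lt_one (mul_nonneg (sq_nonneg _) (pow_nonneg h0 C)) hC)
    (Eventually.of_forall fun n => ?_)⟩
  refine (columnLaw_real_compl_forall_exists_le n _).trans_eq ?_
  rw [mul_pow, pow_mul, ← hθ, pow_right_comm]

/-- The first `2 * n` columns have with high probability no circuit of sublinear size. -/
theorem exists_highProb_noShortRelation [DecidableEq F] : ∃ K : ℕ, 1 ≤ K ∧
    HighProb F fun n => {v : ℕ → Fin n → F | NoShortRelation v (2 * n) (n / K)} := by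
  have hq2 : (2 : ℝ) ≤ Fintype.card F := by exact_mod_cast Fintype.one_lt_card (α := F)
  -- With t = 8q in the weight enumerator, t^(n/K) ≤ (3/2)^n, and (3/2)(9/8)²(1/2) = 243/256 < 1.
  obtain ⟨K, hK, hK1⟩ := (((tendsto_pow_atTop_atTop_of_one_lt
    (show (1 : ℝ) < 3 / 2 by norm_num)).eventually_ge_atTop (8 * (Fintype.card F : ℝ))).and
    (eventually_ge_atTop 1)).exists
  refine ⟨K, hK1, HighProb.of_le (tendsto_pow_atTop_nhds_zero_of_lt_one
    (show (0 : ℝ) ≤ 243 / 256 by norm_num) (by norm_num)) (Eventually.of_forall fun n => ?_)⟩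
  refine (columnLaw_real_compl_noShortRelation_le n _ _).trans ?_
  have h1 := card_filter_hammingNorm_le (F := F) (2 * n) (n / K)
    (show (1 : ℝ) ≤ 8 * (Fintype.card F : ℝ) by linarith)
  have h2 : (8 * (Fintype.card F : ℝ)) ^ (n / K) ≤ (3 / 2) ^ n := by
    refine (pow_le_pow_left₀ (by positivity) hK _).trans ?_
    rw [← pow_mul]
    exact pow_le_pow_right₀ (by norm_num) (Nat.mul_div_le n K)
  have h3 : (1 : ℝ) + Fintype.card F / (8 * Fintype.card F) = 9 / 8 := by
    field_simp; norm_num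
  have h4 : ((Fintype.card F : ℝ) ^ n)⁻¹ ≤ (1 / 2) ^ n := by
    rw [← inv_pow, one_div]
    exact pow_le_pow_left₀ (by positivity) (inv_anti₀ (by norm_num) hq2) n
  rw [h3] at h1
  calc _ ≤ (3 / 2 : ℝ) ^ n * (9 / 8) ^ (2 * n) * (1 / 2) ^ n := by
        refine mul_le_mul (h1.trans (mul_le_mul_of_nonneg_right h2 (by positivity))) h4
          (by positivity) (by positivity)
    _ = (243 / 256) ^ n := by
        rw [pow_mul, ← mul_pow, ← mul_pow]
        norm_num

end Asymptotic

end RandomMatroid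

/-! ### Assembly of the three claims -/

theorem mainTheorem8 (F : Type*) [Field F] [Fintype F] [MeasurableSpace F]
    [MeasurableSingletonClass F] :
    -- (a)
    RandomMatroid.AAS F (fun n => {v : ℕ → Fin n → F |
      ∀ m m' : ℕ, 2 ≤ m → m ≤ m' → RandomMatroid.kappa v m ≤ RandomMatroid.kappa v m'}) ∧
    -- (b)
    (∀ f : ℕ → ℝ, f =o[atTop] (fun n : ℕ => (n : ℝ)) →
      RandomMatroid.AAS F (fun n => {v : ℕ → Fin n → F |
        ∀ m : ℕ, 1 ≤ m → |(m : ℝ) - n| ≤ f n →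
          RandomMatroid.tutte v m = RandomMatroid.kappa v m})) ∧
    -- (c)
    (∃ c C : ℝ, 0 < c ∧ 0 < C ∧
      RandomMatroid.AAS F (fun n => {v : ℕ → Fin n → F |
        ∃ mhat : ℕ, c * n ≤ mhat ∧ (mhat : ℝ) ≤ C * n ∧
          (∀ m : ℕ, 1 ≤ m → m < mhat → RandomMatroid.tutte v m = RandomMatroid.kappa v m) ∧
          (∀ m : ℕ, mhat ≤ m → RandomMatroid.tutte v m < RandomMatroid.kappa v m)})) := by
  classical
  refine ⟨?_, fun f hf => ?_, ?_⟩
  · refine ((RandomMatroid.highProb_isTypical F).mono ?_).aas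
    filter_upwards [RandomMatroid.eventually_two_le_sub_window F] with n hn v hv m m' hm hmm'
    exact hv.kappa_mono hn hm hmm'
  · obtain ⟨K, hK, hshort⟩ := RandomMatroid.exists_highProb_noShortRelation F
    refine (((RandomMatroid.highProb_noShortRelation_sub_window F).inter hshort).mono ?_).aas
    -- Each of |m - n|, w and 1 is made at most n/(8K). This leaves room both for d + w + 1 ≤ n/K
    -- and for 2w + d + 1 < n.
    filter_upwards [RandomMatroid.eventually_mul_window_le F (8 * K),
      hf.bound (show (0 : ℝ) < 1 / (8 * K) by positivity), eventually_ge_atTop (8 * K)]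
      with n hw hfn hn v hv m hm hmn
    rw [Real.norm_eq_abs, Real.norm_eq_abs, Nat.abs_cast] at hfn
    have hmn' : |(m : ℝ) - n| ≤ n / (8 * K) := by
      refine (hmn.trans (le_abs_self _)).trans (hfn.trans_eq ?_)
      ring
    have hd : |(m : ℝ) - n| * (8 * K) ≤ n := (le_div_iff₀ (by positivity)).1 hmn'
    obtain ⟨d, hdK, hmd, hdm⟩ : ∃ d : ℕ, 8 * K * d ≤ n ∧ m ≤ n + d ∧ n ≤ m + d := by
      refine ⟨((m : ℤ) - n).natAbs, ?_, by omega, by omega⟩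
      have : ((8 * K * ((m : ℤ) - n).natAbs : ℕ) : ℝ) ≤ n := by
        push_cast [Nat.cast_natAbs]
        linarith
      exact_mod_cast this
    have h1 : 8 * K * d + 8 * K * RandomMatroid.window F n + 8 * K ≤ 3 * n := by omega
    have hle : d + RandomMatroid.window F n + 1 ≤ n / K := by
      rw [Nat.le_div_iff_mul_le (by omega)]
      nlinarith
    have hdn : 8 * d ≤ n := by nlinarith
    have hwn : 8 * RandomMatroid.window F n ≤ n := by nlinarith
    exact hv.1.tutte_eq_kappa hv.2 (by omega) hmd hle (by omega)
  · obtain ⟨C, hC, hcover⟩ := RandomMatroid.exists_highProb_forall_exists F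
    refine ⟨1, C, one_pos, by positivity,
      (((RandomMatroid.highProb_isTypical F).inter hcover).mono ?_).aas⟩
    filter_upwards [RandomMatroid.eventually_two_le_sub_window F] with n hn v hv
    obtain ⟨mhat, h1, h2, h3⟩ := hv.1.exists_threshold (m := C * n) hn
      (by nlinarith [Nat.sub_le n (RandomMatroid.window F n)])
      (RandomMatroid.kappa_eq_top_of_forall_exists hv.2)
    exact ⟨mhat, by simpa using h1, by exact_mod_cast h2, h3⟩
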